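/- Norms are the normalized norms of $L_p(0,2\pi)$: $\|f\|_1=\frac1{2\pi}\int_0^{2\pi}|f(x)|\,dx$, and $\|f\|_\infty$ is the essential supremum of $|f|$ on $(0,2\pi)$. There are absolute constants $\alpha,\beta,\gamma>0$ such that the following holds. Let $q>1$, let $\{m_j\}_{j=1}^\infty$ be a sequence of positive integers with $m_{j+1}/m_j\ge q$ for all $j\ge1$, and let $\{d_j\}_{j=1}^\infty$ be a sequence of integers with $1\le d_j\le m_{j+1}-m_j$ for all $j\ge 1$. Then there is a sequence of trigonometric polynomials $\{\delta_j\}_{j=1}^\infty$ of the form $$\delta_j(x)=\sum_{m_j\le s<m_j+d_j}c_s e^{isx},\qquad c_s\in\mathbb R,$$ such that for all $j\ge1$ $$\frac18\le\|\delta_j\|_1\le\|\delta_j\|_\infty\le 7,$$ and for all $N=1,2,\dots$ $$\Big\|\sum_{j=1}^N\delta_j\Big\|_\infty\le\alpha+\beta\sqrt N+\gamma\max_{1\le j\le N}\log_q\max\Big(\frac{m_j}{d_j},\frac1{\ln q},1\Big).$$ -/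

import Mathlib

open MeasureTheory

/-- Lebesgue measure on `(0, 2π)`, normalized to total mass `1`. The norms `‖f‖_p` of
`L_p(0, 2π)` are the (extended-real valued) norms `eLpNorm f p circleMeasure`. -/
noncomputable def circleMeasure : Measure ℝ :=
  (ENNReal.ofReal (2 * Real.pi))⁻¹ • volume.restrict (Set.Ioo 0 (2 * Real.pi))

/-- The function `f : ℝ → ℂ` is a trigonometric polynomial with real coefficients whose
frequencies lie in `[m, m + d)`, i.e. `f x = ∑_{m ≤ s < m + d} c_s e^{isx}` with real `c_s`. -/
def IsTrigPolyOn (m d : ℕ) (f : ℝ → ℂ) : Prop :=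
  ∃ c : ℕ → ℝ, ∀ x : ℝ,
    f x = ∑ s ∈ Finset.Ico m (m + d), (c s : ℂ) * Complex.exp (Complex.I * (s : ℂ) * (x : ℂ))

/-!
The block `δ_j` has modulus essentially `max (0, 1 - |S| / (2 √j))`, where `S` is an earlier partial
sum: where `S` is already large `δ_j` nearly vanishes, so the partial sums never exceed `O(√N)` plus
the number of blocks that were not taken into account. Since the blocks are orthogonal and bounded
by `1`, the mean square of `S` is at most `j`, which keeps the mean of the amplitude above `1 / 2`.

The amplitude is turned into a polynomial of degree less than `d_j / 2` by convolution with a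
nonnegative kernel, and then modulated into the window. The smoothing error is at most the Lipschitz
constant of `S` divided by `d_j`, up to a factor; by lacunarity, leaving out the last
`2 log_q (j max (m_j / d_j, 1 / ln q, 1))` blocks from `S` makes this error summable in `j`. The
kernel is a squared modulus, so all its estimates reduce to Parseval's identity and the
Cauchy–Schwarz inequality. The coefficients come out real because the amplitude is even, which holds
because `S` has real coefficients.
-/

open Finset
open scoped ComplexConjugate

section CircleMeasure

variable {E : Type*} [NormedAddCommGroup E]

instance isProbabilityMeasure_circleMeasure : IsProbabilityMeasure circleMeasure := by
  constructor
  have h2π : ENNReal.ofReal (2 * Real.pi) ≠ 0 := by simp [Real.pi_pos]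
  rw [circleMeasure, Measure.smul_apply, Measure.restrict_apply_univ, Real.volume_Ioo, sub_zero,
    smul_eq_mul, ENNReal.inv_mul_cancel h2π ENNReal.ofReal_ne_top]

lemma ae_mem_Ioo_circleMeasure : ∀ᵐ x ∂circleMeasure, x ∈ Set.Ioo 0 (2 * Real.pi) :=
  Measure.ae_smul_measure (ae_restrict_mem measurableSet_Ioo) _

lemma memLp_circleMeasure {f : ℝ → E} (hf : Continuous f)
    (p : ENNReal) : MemLp f p circleMeasure := by
  obtain ⟨C, hC⟩ :=
    isCompact_Icc.exists_bound_of_continuousOn (hf.continuousOn (s := Set.Icc 0 (2 * Real.pi)))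
  refine .of_bound hf.aestronglyMeasurable C ?_
  filter_upwards [ae_mem_Ioo_circleMeasure] with x hx using hC x (Set.Ioo_subset_Icc_self hx)

lemma integrable_circleMeasure {f : ℝ → E} (hf : Continuous f) :
    Integrable f circleMeasure :=
  (memLp_circleMeasure hf 1).integrable le_rfl

lemma eLpNorm_top_circleMeasure_le {f : ℝ → E} {C : ℝ} (hf : ∀ x, ‖f x‖ ≤ C) :
    eLpNorm f ⊤ circleMeasure ≤ ENNReal.ofReal C := by
  rw [eLpNorm_exponent_top]
  exact eLpNormEssSup_le_of_ae_bound (.of_forall hf)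

variable [NormedSpace ℝ E]

lemma integral_circleMeasure (f : ℝ → E) :
    ∫ x, f x ∂circleMeasure = (2 * Real.pi)⁻¹ • ∫ x in (0 : ℝ)..(2 * Real.pi), f x := by
  have h0 : (0 : ℝ) ≤ 2 * Real.pi := by positivity
  rw [circleMeasure, integral_smul_measure, intervalIntegral.integral_of_le h0,
    integral_Ioc_eq_integral_Ioo, ENNReal.toReal_inv, ENNReal.toReal_ofReal h0]

lemma integral_comp_neg_circleMeasure {f : ℝ → E} (hf : Function.Periodic f (2 * Real.pi)) :
    ∫ x, f (-x) ∂circleMeasure = ∫ x, f x ∂circleMeasure := by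
  have h := hf.intervalIntegral_add_eq (-(2 * Real.pi)) 0
  rw [neg_add_cancel, zero_add] at h
  rw [integral_circleMeasure, integral_circleMeasure, intervalIntegral.integral_comp_neg, neg_zero,
    h]

lemma integral_mul_le_of_integral_sq_le {α : Type*} {mα : MeasurableSpace α} {μ : Measure α}
    {f g : α → ℝ} {A B : ℝ} (hf0 : ∀ x, 0 ≤ f x) (hg0 : ∀ x, 0 ≤ g x) (hf : MemLp f 2 μ)
    (hg : MemLp g 2 μ) (hA : 0 ≤ A) (hB : 0 ≤ B) (hfA : ∫ x, f x ^ 2 ∂μ ≤ A ^ 2)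
    (hgB : ∫ x, g x ^ 2 ∂μ ≤ B ^ 2) : ∫ x, f x * g x ∂μ ≤ A * B := by
  have hölder := integral_mul_le_Lp_mul_Lq_of_nonneg Real.HolderConjugate.two_two
    (.of_forall hf0) (.of_forall hg0) (by simpa using hf) (by simpa using hg)
  simp only [Real.rpow_two, ← Real.sqrt_eq_rpow] at hölder
  exact hölder.trans (mul_le_mul (Real.sqrt_le_iff.2 ⟨hA, hfA⟩) (Real.sqrt_le_iff.2 ⟨hB, hgB⟩)
    (Real.sqrt_nonneg _) hA)

end CircleMeasure

section FourierMode

/-- The character `x ↦ e^{ikx}` of the circle, as a function on `ℝ`. -/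
noncomputable def fourierMode (k : ℤ) (x : ℝ) : ℂ := Complex.exp (Complex.I * k * x)

lemma fourierMode_zero_left (x : ℝ) : fourierMode 0 x = 1 := by simp [fourierMode]

lemma fourierMode_add_left (k l : ℤ) (x : ℝ) :
    fourierMode (k + l) x = fourierMode k x * fourierMode l x := by
  simp only [fourierMode, ← Complex.exp_add]
  push_cast
  ring_nf

lemma fourierMode_natCast (k : ℕ) (x : ℝ) : fourierMode k x = fourierMode 1 x ^ k := by
  simp only [fourierMode, ← Complex.exp_nat_mul]
  push_cast
  ring_nf

lemma fourierMode_add_right (k : ℤ) (x y : ℝ) :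
    fourierMode k (x + y) = fourierMode k x * fourierMode k y := by
  simp only [fourierMode, ← Complex.exp_add]
  push_cast
  ring_nf

lemma conj_fourierMode (k : ℤ) (x : ℝ) : conj (fourierMode k x) = fourierMode (-k) x := by
  simp [fourierMode, ← Complex.exp_conj]

lemma fourierMode_neg_right (k : ℤ) (x : ℝ) : fourierMode k (-x) = conj (fourierMode k x) := by
  simp [fourierMode, ← Complex.exp_conj]

lemma fourierMode_sub_right (k : ℤ) (x y : ℝ) :
    fourierMode k (x - y) = fourierMode k x * conj (fourierMode k y) := by
  rw [sub_eq_add_neg, fourierMode_add_right, fourierMode_neg_right]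

lemma norm_fourierMode (k : ℤ) (x : ℝ) : ‖fourierMode k x‖ = 1 := by
  simp [fourierMode, Complex.norm_exp]

@[fun_prop]
lemma continuous_fourierMode (k : ℤ) : Continuous (fourierMode k) := by
  unfold fourierMode
  fun_prop

lemma periodic_fourierMode (k : ℤ) : Function.Periodic (fourierMode k) (2 * Real.pi) := fun x => by
  have h2π : fourierMode k (2 * Real.pi) = 1 :=
    Complex.exp_eq_one_iff.2 ⟨k, by push_cast; ring⟩
  rw [fourierMode_add_right, h2π, mul_one]

lemma integral_fourierMode (k : ℤ) :
    ∫ x, fourierMode k x ∂circleMeasure = if k = 0 then 1 else 0 := by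
  split_ifs with hk
  · simp [hk, fourierMode_zero_left]
  · have hc : Complex.I * k ≠ 0 := mul_ne_zero Complex.I_ne_zero (by exact_mod_cast hk)
    have hper : fourierMode k (2 * Real.pi) = fourierMode k 0 := by
      simpa using periodic_fourierMode k 0
    simp only [fourierMode] at hper ⊢
    rw [integral_circleMeasure, integral_exp_mul_complex hc, hper, sub_self, zero_div, smul_zero]

lemma integral_norm_sq_sum_fourierMode {ι : Type*} (s : Finset ι) {ν : ι → ℤ}
    (hν : Function.Injective ν) (c : ι → ℂ) :
    ∫ x, ‖∑ k ∈ s, c k * fourierMode (ν k) x‖ ^ 2 ∂circleMeasure = ∑ k ∈ s, ‖c k‖ ^ 2 := by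
  classical
  have hexpand (x : ℝ) : ((‖∑ k ∈ s, c k * fourierMode (ν k) x‖ ^ 2 : ℝ) : ℂ) =
      ∑ k ∈ s, ∑ l ∈ s, c k * conj (c l) * fourierMode (ν k - ν l) x := by
    push_cast
    rw [← Complex.mul_conj', map_sum, sum_mul_sum]
    refine sum_congr rfl fun k _ => sum_congr rfl fun l _ => ?_
    rw [map_mul, conj_fourierMode, sub_eq_add_neg, fourierMode_add_left]
    ring
  rw [← Complex.ofReal_inj, ← integral_complex_ofReal]
  simp only [hexpand]
  rw [integral_finsetSum _ fun k _ => integrable_circleMeasure (by fun_prop)]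
  push_cast
  refine sum_congr rfl fun k hk => ?_
  rw [integral_finsetSum _ fun l _ => integrable_circleMeasure (by fun_prop)]
  simp [integral_const_mul, integral_fourierMode, sub_eq_zero, hν.eq_iff, hk, Complex.mul_conj']

end FourierMode

section ChordDist

/-- The chordal distance `|e^{ix} - e^{iy}|`, in which all Lipschitz estimates are expressed. -/
noncomputable def chordDist (x y : ℝ) : ℝ := ‖fourierMode 1 x - fourierMode 1 y‖

lemma chordDist_nonneg (x y : ℝ) : 0 ≤ chordDist x y := norm_nonneg _

lemma chordDist_self (x : ℝ) : chordDist x x = 0 := by simp [chordDist]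

lemma chordDist_eq_norm_sub_one (x y : ℝ) : chordDist x y = ‖fourierMode 1 (x - y) - 1‖ := by
  have hfactor : fourierMode 1 x - fourierMode 1 y =
      fourierMode 1 y * (fourierMode 1 (x - y) - 1) := by
    rw [mul_sub_one, ← fourierMode_add_right, add_sub_cancel]
  rw [chordDist, hfactor, norm_mul, norm_fourierMode, one_mul]

@[fun_prop]
lemma continuous_chordDist_left (y : ℝ) : Continuous fun x => chordDist x y := by
  unfold chordDist
  fun_prop

/-- `f` is Lipschitz with constant `L` for the chordal distance. -/
def ChordLipschitz {E : Type*} [NormedAddCommGroup E] (L : ℝ) (f : ℝ → E) : Prop :=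
  ∀ x y, ‖f x - f y‖ ≤ L * chordDist x y

namespace ChordLipschitz

variable {E ι : Type*} [NormedAddCommGroup E] {K L : ℝ}

lemma mono {f : ℝ → E} (hf : ChordLipschitz K f) (hKL : K ≤ L) : ChordLipschitz L f :=
  fun x y => (hf x y).trans (mul_le_mul_of_nonneg_right hKL (chordDist_nonneg x y))

lemma sum {s : Finset ι} {K : ι → ℝ} {f : ι → ℝ → E} (hf : ∀ i ∈ s, ChordLipschitz (K i) (f i)) :
    ChordLipschitz (∑ i ∈ s, K i) fun x => ∑ i ∈ s, f i x := fun x y => by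
  rw [← sum_sub_distrib, sum_mul]
  exact norm_sum_le_of_le _ fun i hi => hf i hi x y

protected lemma continuous {f : ℝ → E} (hf : ChordLipschitz L f) : Continuous f := by
  refine continuous_iff_continuousAt.2 fun y => tendsto_iff_norm_sub_tendsto_zero.2 ?_
  refine squeeze_zero (fun _ => norm_nonneg _) (fun x => hf x y) ?_
  have hlim := (continuous_chordDist_left y).tendsto y
  rw [chordDist_self] at hlim
  simpa using hlim.const_mul L

lemma mul_of_norm_le_one {f g : ℝ → ℂ} (hf : ChordLipschitz K f) (hg : ChordLipschitz L g)
    (hf1 : ∀ x, ‖f x‖ ≤ 1) (hg1 : ∀ x, ‖g x‖ ≤ 1) :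
    ChordLipschitz (K + L) fun x => f x * g x := fun x y =>
  calc ‖f x * g x - f y * g y‖ = ‖(f x - f y) * g x + f y * (g x - g y)‖ := by ring_nf
    _ ≤ ‖f x - f y‖ * ‖g x‖ + ‖f y‖ * ‖g x - g y‖ := by
        simpa only [norm_mul] using norm_add_le ((f x - f y) * g x) (f y * (g x - g y))
    _ ≤ K * chordDist x y * 1 + 1 * (L * chordDist x y) := by
        gcongr
        exacts [(norm_nonneg _).trans (hf x y), hf x y, hg1 x, hf1 y, hg x y]
    _ = (K + L) * chordDist x y := by ring

end ChordLipschitz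

lemma chordLipschitz_fourierMode (k : ℕ) : ChordLipschitz k (fourierMode k) := fun x y => by
  simp only [fourierMode_natCast]
  rw [← (Commute.all (fourierMode 1 x) _).mul_geom_sum₂, norm_mul, mul_comm, chordDist]
  gcongr
  refine (norm_sum_le_of_le _ fun i _ => (?_ : _ ≤ (1 : ℝ))).trans_eq (by simp)
  simp [norm_fourierMode]

end ChordDist

namespace IsTrigPolyOn

variable {m d m' d' : ℕ} {f g : ℝ → ℂ}

lemma iff_fourierMode : IsTrigPolyOn m d f ↔
    ∃ c : ℕ → ℝ, f = fun x => ∑ s ∈ Ico m (m + d), (c s : ℂ) * fourierMode s x := by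
  simp only [IsTrigPolyOn, fourierMode, Int.cast_natCast, funext_iff]

lemma zero (m d : ℕ) : IsTrigPolyOn m d fun _ => 0 := ⟨fun _ => 0, by simp⟩

lemma add (hf : IsTrigPolyOn m d f) (hg : IsTrigPolyOn m d g) :
    IsTrigPolyOn m d fun x => f x + g x := by
  obtain ⟨b, hb⟩ := hf
  obtain ⟨c, hc⟩ := hg
  exact ⟨b + c, fun x => by simp [hb, hc, sum_add_distrib, add_mul]⟩

lemma sum {ι : Type*} {s : Finset ι} {f : ι → ℝ → ℂ} (hf : ∀ i ∈ s, IsTrigPolyOn m d (f i)) :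
    IsTrigPolyOn m d fun x => ∑ i ∈ s, f i x := by
  simp only [← Finset.sum_apply]
  exact sum_induction f (IsTrigPolyOn m d) (fun _ _ => add) (zero m d) hf

lemma monomial {s : ℕ} (hs : s ∈ Ico m (m + d)) (c : ℝ) :
    IsTrigPolyOn m d fun x => (c : ℂ) * fourierMode s x :=
  iff_fourierMode.2 ⟨Pi.single s c, funext fun x => by
    rw [sum_eq_single_of_mem s hs fun t _ hts => by simp [hts], Pi.single_eq_same]⟩

lemma mono (hf : IsTrigPolyOn m d f) (hm : m' ≤ m) (hd : m + d ≤ m' + d') :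
    IsTrigPolyOn m' d' f := by
  obtain ⟨c, rfl⟩ := iff_fourierMode.1 hf
  exact sum fun s hs => monomial (Ico_subset_Ico hm hd hs) _

protected lemma continuous (hf : IsTrigPolyOn m d f) : Continuous f := by
  obtain ⟨c, rfl⟩ := iff_fourierMode.1 hf
  fun_prop

lemma periodic (hf : IsTrigPolyOn m d f) : Function.Periodic f (2 * Real.pi) := fun x => by
  obtain ⟨c, rfl⟩ := iff_fourierMode.1 hf
  simp only [periodic_fourierMode _ x]

lemma apply_neg (hf : IsTrigPolyOn m d f) (x : ℝ) : f (-x) = conj (f x) := by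
  obtain ⟨c, rfl⟩ := iff_fourierMode.1 hf
  simp [fourierMode_neg_right]

lemma integral_mul_conj_eq_zero (hf : IsTrigPolyOn m d f) (hg : IsTrigPolyOn m' d' g)
    (hdisj : m + d ≤ m') : ∫ x, f x * conj (g x) ∂circleMeasure = 0 := by
  obtain ⟨b, rfl⟩ := iff_fourierMode.1 hf
  obtain ⟨c, rfl⟩ := iff_fourierMode.1 hg
  have hexpand (x : ℝ) : (∑ s ∈ Ico m (m + d), (b s : ℂ) * fourierMode s x) *
      conj (∑ t ∈ Ico m' (m' + d'), (c t : ℂ) * fourierMode t x) =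
      ∑ s ∈ Ico m (m + d), ∑ t ∈ Ico m' (m' + d'),
        (b s * c t : ℂ) * fourierMode (s + -t) x := by
    rw [map_sum, sum_mul_sum]
    refine sum_congr rfl fun s _ => sum_congr rfl fun t _ => ?_
    rw [map_mul, conj_fourierMode, Complex.conj_ofReal, fourierMode_add_left]
    ring
  simp only [hexpand]
  rw [integral_finsetSum _ fun s _ => integrable_circleMeasure (by fun_prop)]
  refine sum_eq_zero fun s hs => ?_
  rw [integral_finsetSum _ fun t _ => integrable_circleMeasure (by fun_prop)]
  refine sum_eq_zero fun t ht => ?_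
  rw [mem_Ico] at hs ht
  rw [integral_const_mul, integral_fourierMode, if_neg (by omega), mul_zero]

lemma integral_norm_add_sq (hf : IsTrigPolyOn m d f) (hg : IsTrigPolyOn m' d' g)
    (hdisj : m + d ≤ m') : ∫ x, ‖f x + g x‖ ^ 2 ∂circleMeasure =
      ∫ x, ‖f x‖ ^ 2 ∂circleMeasure + ∫ x, ‖g x‖ ^ 2 ∂circleMeasure := by
  have hfc := hf.continuous
  have hgc := hg.continuous
  have hcross : ∫ x, (f x * conj (g x)).re ∂circleMeasure = 0 := by
    have hint : Integrable (fun x => f x * conj (g x)) circleMeasure :=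
      integrable_circleMeasure (by fun_prop)
    have hre := integral_re hint
    simpa [hf.integral_mul_conj_eq_zero hg hdisj] using hre
  simp only [Complex.sq_norm, Complex.normSq_add]
  rw [integral_add, integral_add, integral_const_mul, hcross, mul_zero, add_zero]
  all_goals exact integrable_circleMeasure (by fun_prop)

end IsTrigPolyOn

section TrigPoly

/-- The trigonometric polynomial `∑_{k < n} c_k e^{ikx}`, whose squared modulus serves as a
nonnegative smoothing kernel of degree less than `n`. -/
noncomputable def trigPoly (c : ℕ → ℂ) (n : ℕ) (x : ℝ) : ℂ :=
  ∑ k ∈ range n, c k * fourierMode k x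

variable (c : ℕ → ℂ) (n : ℕ)

@[fun_prop]
lemma continuous_trigPoly : Continuous (trigPoly c n) := by
  unfold trigPoly
  fun_prop

lemma trigPoly_sub_right (t x : ℝ) :
    trigPoly c n (t - x) = trigPoly (fun k => c k * conj (fourierMode k x)) n t :=
  sum_congr rfl fun k _ => by rw [fourierMode_sub_right]; ring

lemma integral_norm_trigPoly_sq :
    ∫ t, ‖trigPoly c n t‖ ^ 2 ∂circleMeasure = ∑ k ∈ range n, ‖c k‖ ^ 2 :=
  integral_norm_sq_sum_fourierMode (range n) Nat.cast_injective c

lemma integral_norm_trigPoly_sub_right_sq (x : ℝ) :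
    ∫ t, ‖trigPoly c n (t - x)‖ ^ 2 ∂circleMeasure = ∑ k ∈ range n, ‖c k‖ ^ 2 := by
  simp [trigPoly_sub_right, integral_norm_trigPoly_sq, norm_fourierMode]

lemma integral_norm_trigPoly_translate_sub_sq_le (x y : ℝ) :
    ∫ t, ‖trigPoly c n (t - x) - trigPoly c n (t - y)‖ ^ 2 ∂circleMeasure ≤
      (n * chordDist x y) ^ 2 * ∑ k ∈ range n, ‖c k‖ ^ 2 := by
  have hsub (t : ℝ) : trigPoly c n (t - x) - trigPoly c n (t - y) =
      trigPoly (fun k => c k * conj (fourierMode k x - fourierMode k y)) n t := by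
    rw [trigPoly_sub_right, trigPoly_sub_right]
    simp only [trigPoly, ← sum_sub_distrib, map_sub, mul_sub, sub_mul]
  simp only [hsub, integral_norm_trigPoly_sq, norm_mul, RCLike.norm_conj, mul_sum]
  refine sum_le_sum fun k hk => ?_
  rw [mul_pow, mul_comm]
  gcongr
  refine (chordLipschitz_fourierMode k x y).trans ?_
  have := chordDist_nonneg x y
  gcongr
  exact (mem_range.1 hk).le

lemma fourierMode_one_sub_one_mul_trigPoly {c : ℕ → ℂ} {n : ℕ} (h0 : c 0 = 0)
    (hn : c (n + 1) = 0) (x : ℝ) : (fourierMode 1 x - 1) * trigPoly (fun k => c (k + 1)) n x =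
      trigPoly (fun k => c k - c (k + 1)) (n + 1) x := by
  have hshift : fourierMode 1 x * trigPoly (fun k => c (k + 1)) n x = trigPoly c (n + 1) x := by
    simp only [trigPoly, sum_range_succ', h0, zero_mul, add_zero, mul_sum, Nat.cast_succ,
      fourierMode_add_left]
    exact sum_congr rfl fun k _ => by ring
  have hextend : trigPoly (fun k => c (k + 1)) n x = trigPoly (fun k => c (k + 1)) (n + 1) x := by
    simp [trigPoly, sum_range_succ, hn]
  rw [sub_one_mul, hshift, hextend]
  simp only [trigPoly, ← sum_sub_distrib, sub_mul]

lemma integral_sq_chordDist_mul_norm_trigPoly {c : ℕ → ℂ} {n : ℕ} (h0 : c 0 = 0)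
    (hn : c (n + 1) = 0) (x : ℝ) :
    ∫ t, (chordDist t x * ‖trigPoly (fun k => c (k + 1)) n (t - x)‖) ^ 2 ∂circleMeasure =
      ∑ k ∈ range (n + 1), ‖c k - c (k + 1)‖ ^ 2 := by
  simp only [chordDist_eq_norm_sub_one, ← norm_mul, fourierMode_one_sub_one_mul_trigPoly h0 hn]
  exact integral_norm_trigPoly_sub_right_sq _ _ x

end TrigPoly

section ParabolicCoeff

lemma sum_range_parabola_sq (N : ℝ) (n : ℕ) :
    ∑ k ∈ range n, (((k + 1 : ℕ) : ℝ) * (N - (k + 1 : ℕ))) ^ 2 =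
      N ^ 2 * (n * (n + 1) * (2 * n + 1) / 6) - 2 * N * (n * (n + 1) / 2) ^ 2 +
        n * (n + 1) * (2 * n + 1) * (3 * n ^ 2 + 3 * n - 1) / 30 := by
  induction n with
  | zero => simp
  | succ n ih => rw [sum_range_succ, ih]; push_cast; ring

lemma sum_range_parabola_increment_sq (N : ℝ) (n : ℕ) :
    ∑ k ∈ range n, ((k : ℝ) * (N - k) - ((k + 1 : ℕ) : ℝ) * (N - (k + 1 : ℕ))) ^ 2 =
      n * (N - 1) ^ 2 - 2 * (N - 1) * (n * (n - 1)) + 2 * (n * (n - 1) * (2 * n - 1)) / 3 := by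
  induction n with
  | zero => simp
  | succ n ih => rw [sum_range_succ, ih]; push_cast; ring

/-- The parabola `k (n + 1 - k)`, vanishing at `0` and `n + 1`, normalized in `ℓ²`. It stands in
for the half-period sine, the exact minimizer of the energy of increments. -/
noncomputable def parabolicCoeff (n k : ℕ) : ℝ :=
  k * (n + 1 - k) / Real.sqrt (((n + 1 : ℝ) ^ 5 - (n + 1)) / 30)

lemma parabolicCoeff_zero (n : ℕ) : parabolicCoeff n 0 = 0 := by simp [parabolicCoeff]

lemma parabolicCoeff_succ_self (n : ℕ) : parabolicCoeff n (n + 1) = 0 := by simp [parabolicCoeff]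

lemma parabolicCoeff_energy_pos {n : ℕ} (hn : 1 ≤ n) :
    (0 : ℝ) < ((n + 1 : ℝ) ^ 5 - (n + 1)) / 30 := by
  have hfactor : ((n + 1 : ℝ) ^ 5 - (n + 1)) / 30 =
      n * ((n + 1) * (n + 2) * ((n + 1) ^ 2 + 1) / 30) := by ring
  rw [hfactor]
  exact mul_pos (Nat.cast_pos.2 hn) (by positivity)

lemma sum_parabolicCoeff_sq {n : ℕ} (hn : 1 ≤ n) :
    ∑ k ∈ range n, parabolicCoeff n (k + 1) ^ 2 = 1 := by
  have hW := parabolicCoeff_energy_pos hn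
  simp only [parabolicCoeff, div_pow, Real.sq_sqrt hW.le, ← sum_div, sum_range_parabola_sq]
  rw [div_eq_one_iff_eq hW.ne']
  ring

lemma sum_parabolicCoeff_increment_sq_le {n : ℕ} (hn : 1 ≤ n) :
    ∑ k ∈ range (n + 1), (parabolicCoeff n k - parabolicCoeff n (k + 1)) ^ 2 ≤
      10 / (n + 1 : ℝ) ^ 2 := by
  have hW := parabolicCoeff_energy_pos hn
  simp only [parabolicCoeff, ← sub_div, div_pow, Real.sq_sqrt hW.le, ← sum_div,
    sum_range_parabola_increment_sq]
  rw [div_le_div_iff₀ hW (by positivity)]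
  push_cast
  ring_nf
  nlinarith

end ParabolicCoeff

section Smoothing

/-- The average of `f` around `x` with weight `‖∑_{k < n} c_k e^{ik(t - x)}‖²`, which has total mass
`∑ ‖c_k‖²`. As a function of `x` it is a trigonometric polynomial of degree less than `n`. -/
noncomputable def smoothing (c : ℕ → ℂ) (n : ℕ) (f : ℝ → ℝ) (x : ℝ) : ℝ :=
  ∫ t, f t * ‖trigPoly c n (t - x)‖ ^ 2 ∂circleMeasure

variable {c : ℕ → ℂ} {n : ℕ} {f : ℝ → ℝ} {L θ : ℝ}

lemma smoothing_nonneg (hf0 : ∀ t, 0 ≤ f t) (x : ℝ) : 0 ≤ smoothing c n f x :=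
  integral_nonneg fun t => mul_nonneg (hf0 t) (sq_nonneg _)

lemma smoothing_le_one (hc : ∑ k ∈ range n, ‖c k‖ ^ 2 = 1) (hf : Continuous f)
    (hf1 : ∀ t, f t ≤ 1) (x : ℝ) : smoothing c n f x ≤ 1 := by
  rw [← hc, ← integral_norm_trigPoly_sub_right_sq c n x]
  refine integral_mono (integrable_circleMeasure (by fun_prop))
    (integrable_circleMeasure (by fun_prop)) fun t => ?_
  exact mul_le_of_le_one_left (sq_nonneg _) (hf1 t)

lemma smoothing_le_add (hc : ∑ k ∈ range n, ‖c k‖ ^ 2 = 1) (hf : ChordLipschitz L f)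
    (hL : 0 ≤ L) (hθ : 0 ≤ θ) {x : ℝ}
    (hconc : ∫ t, (chordDist t x * ‖trigPoly c n (t - x)‖) ^ 2 ∂circleMeasure ≤ θ ^ 2) :
    smoothing c n f x ≤ f x + L * θ := by
  have hfc := hf.continuous
  have hmass : ∫ t, ‖trigPoly c n (t - x)‖ ^ 2 ∂circleMeasure = 1 := by
    rw [integral_norm_trigPoly_sub_right_sq, hc]
  have hspread : ∫ t, chordDist t x * ‖trigPoly c n (t - x)‖ * ‖trigPoly c n (t - x)‖
      ∂circleMeasure ≤ θ * 1 :=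
    integral_mul_le_of_integral_sq_le
      (fun t => mul_nonneg (chordDist_nonneg t x) (norm_nonneg _)) (fun t => norm_nonneg _)
      (memLp_circleMeasure (by fun_prop) 2) (memLp_circleMeasure (by fun_prop) 2) hθ zero_le_one
      hconc (by rw [hmass, one_pow])
  have hpointwise (t : ℝ) : f t * ‖trigPoly c n (t - x)‖ ^ 2 ≤ f x * ‖trigPoly c n (t - x)‖ ^ 2 +
      L * (chordDist t x * ‖trigPoly c n (t - x)‖ * ‖trigPoly c n (t - x)‖) := by
    have hft : f t ≤ f x + L * chordDist t x := by linarith [(le_abs_self _).trans (hf t x)]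
    nlinarith [mul_le_mul_of_nonneg_right hft (sq_nonneg ‖trigPoly c n (t - x)‖)]
  calc smoothing c n f x
      ≤ ∫ t, (f x * ‖trigPoly c n (t - x)‖ ^ 2 +
          L * (chordDist t x * ‖trigPoly c n (t - x)‖ * ‖trigPoly c n (t - x)‖))
          ∂circleMeasure :=
        integral_mono (integrable_circleMeasure (by fun_prop))
          (integrable_circleMeasure (by fun_prop)) hpointwise
    _ = f x + L * ∫ t, chordDist t x * ‖trigPoly c n (t - x)‖ * ‖trigPoly c n (t - x)‖
          ∂circleMeasure := by
        rw [integral_add (integrable_circleMeasure (by fun_prop))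
          (integrable_circleMeasure (by fun_prop)), integral_const_mul, integral_const_mul, hmass,
          mul_one]
    _ ≤ f x + L * θ := by
        rw [mul_one] at hspread
        gcongr

lemma integral_norm_trigPoly_translate_sub_mul_le (hc : ∑ k ∈ range n, ‖c k‖ ^ 2 = 1)
    (x y z : ℝ) :
    ∫ t, ‖trigPoly c n (t - x) - trigPoly c n (t - y)‖ * ‖trigPoly c n (t - z)‖ ∂circleMeasure ≤
      n * chordDist x y := by
  have hdiff := integral_norm_trigPoly_translate_sub_sq_le c n x y
  have hmass := integral_norm_trigPoly_sub_right_sq c n z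
  rw [hc] at hdiff hmass
  rw [← mul_one (n * chordDist x y)]
  exact integral_mul_le_of_integral_sq_le (fun t => norm_nonneg _) (fun t => norm_nonneg _)
    (memLp_circleMeasure (by fun_prop) 2) (memLp_circleMeasure (by fun_prop) 2)
    (mul_nonneg n.cast_nonneg (chordDist_nonneg x y)) zero_le_one (by rwa [mul_one] at hdiff)
    (by rw [hmass, one_pow])

lemma abs_norm_sq_sub_norm_sq_le {E : Type*} [SeminormedAddCommGroup E] (u v : E) :
    |‖u‖ ^ 2 - ‖v‖ ^ 2| ≤ ‖u - v‖ * ‖u‖ + ‖u - v‖ * ‖v‖ := by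
  rw [sq_sub_sq, abs_mul, mul_comm, abs_of_nonneg (by positivity : 0 ≤ ‖u‖ + ‖v‖), ← mul_add]
  gcongr
  exact abs_norm_sub_norm_le u v

lemma chordLipschitz_smoothing (hc : ∑ k ∈ range n, ‖c k‖ ^ 2 = 1) (hf : Continuous f)
    (hf1 : ∀ t, |f t| ≤ 1) : ChordLipschitz (2 * n) (smoothing c n f) := fun x y => by
  set u : ℝ → ℂ := fun t => trigPoly c n (t - x)
  set v : ℝ → ℂ := fun t => trigPoly c n (t - y)
  have hpointwise (t : ℝ) : ‖f t * ‖u t‖ ^ 2 - f t * ‖v t‖ ^ 2‖ ≤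
      ‖u t - v t‖ * ‖u t‖ + ‖u t - v t‖ * ‖v t‖ := by
    rw [← mul_sub, norm_mul, Real.norm_eq_abs, Real.norm_eq_abs]
    exact (mul_le_of_le_one_left (abs_nonneg _) (hf1 t)).trans (abs_norm_sq_sub_norm_sq_le _ _)
  calc ‖smoothing c n f x - smoothing c n f y‖
      = ‖∫ t, (f t * ‖u t‖ ^ 2 - f t * ‖v t‖ ^ 2) ∂circleMeasure‖ := by
        rw [integral_sub (integrable_circleMeasure (by fun_prop))
          (integrable_circleMeasure (by fun_prop)), smoothing, smoothing]
    _ ≤ ∫ t, (‖u t - v t‖ * ‖u t‖ + ‖u t - v t‖ * ‖v t‖) ∂circleMeasure :=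
        norm_integral_le_of_norm_le (integrable_circleMeasure (by fun_prop)) (.of_forall hpointwise)
    _ ≤ n * chordDist x y + n * chordDist x y := by
        rw [integral_add (integrable_circleMeasure (by fun_prop))
          (integrable_circleMeasure (by fun_prop))]
        exact add_le_add (integral_norm_trigPoly_translate_sub_mul_le hc x y x)
          (integral_norm_trigPoly_translate_sub_mul_le hc x y y)
    _ = 2 * n * chordDist x y := by ring

lemma smoothing_eq_sum (c : ℕ → ℂ) (n : ℕ) (hf : Continuous f) (x : ℝ) :
    (smoothing c n f x : ℂ) = ∑ k ∈ range n, ∑ l ∈ range n, c k * conj (c l) *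
      (∫ t, f t * fourierMode (k - l) t ∂circleMeasure) * fourierMode (l - k) x := by
  have hexpand (t : ℝ) : ((f t * ‖trigPoly c n (t - x)‖ ^ 2 : ℝ) : ℂ) =
      ∑ k ∈ range n, ∑ l ∈ range n, c k * conj (c l) *
        (f t * fourierMode (k - l) t) * fourierMode (l - k) x := by
    push_cast
    rw [← Complex.mul_conj', trigPoly_sub_right, trigPoly, map_sum, sum_mul_sum, mul_sum]
    refine sum_congr rfl fun k _ => ?_
    rw [mul_sum]
    refine sum_congr rfl fun l _ => ?_
    simp only [map_mul, conj_fourierMode, neg_neg, sub_eq_add_neg, fourierMode_add_left]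
    ring
  rw [smoothing, ← integral_complex_ofReal]
  simp only [hexpand]
  rw [integral_finsetSum _ fun k _ => integrable_circleMeasure (by fun_prop)]
  refine sum_congr rfl fun k _ => ?_
  rw [integral_finsetSum _ fun l _ => integrable_circleMeasure (by fun_prop)]
  refine sum_congr rfl fun l _ => ?_
  rw [integral_mul_const, integral_const_mul]

lemma integral_smoothing (hc : ∑ k ∈ range n, ‖c k‖ ^ 2 = 1) (hf : Continuous f) :
    ∫ x, smoothing c n f x ∂circleMeasure = ∫ t, f t ∂circleMeasure := by
  have hcross (k : ℕ) (hk : k ∈ range n) :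
      ∫ x, ∑ l ∈ range n, c k * conj (c l) *
        (∫ t, f t * fourierMode (k - l) t ∂circleMeasure) * fourierMode (l - k) x ∂circleMeasure =
      (‖c k‖ : ℂ) ^ 2 * ∫ t, (f t : ℂ) ∂circleMeasure := by
    rw [integral_finsetSum _ fun l _ => integrable_circleMeasure (by fun_prop)]
    simp_rw [integral_const_mul, integral_fourierMode, sub_eq_zero, Nat.cast_inj]
    simp [hk, fourierMode_zero_left, Complex.mul_conj']
  rw [← Complex.ofReal_inj, ← integral_complex_ofReal, ← integral_complex_ofReal]
  simp only [smoothing_eq_sum c n hf]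
  rw [integral_finsetSum _ fun k _ => integrable_circleMeasure (by fun_prop),
    sum_congr rfl hcross, ← sum_mul]
  rw [← Complex.ofReal_inj] at hc
  push_cast at hc
  rw [hc, one_mul]

lemma conj_integral_mul_fourierMode (hper : Function.Periodic f (2 * Real.pi))
    (heven : Function.Even f) (k : ℤ) :
    conj (∫ t, f t * fourierMode k t ∂circleMeasure) =
      ∫ t, f t * fourierMode k t ∂circleMeasure := by
  have hper' : Function.Periodic (fun t => (f t : ℂ) * fourierMode k t) (2 * Real.pi) :=
    fun t => by simp only [hper t, periodic_fourierMode k t]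
  rw [← integral_conj, ← integral_comp_neg_circleMeasure hper']
  simp only [map_mul, Complex.conj_ofReal, fourierMode_neg_right, heven _]

lemma isTrigPolyOn_fourierMode_mul_smoothing {c : ℕ → ℝ} {m d r : ℕ} (hr : 2 * r < d)
    (hf : Continuous f) (hper : Function.Periodic f (2 * Real.pi)) (heven : Function.Even f) :
    IsTrigPolyOn m d fun x =>
      fourierMode (m + r : ℕ) x * smoothing (fun k => c k) (r + 1) f x := by
  have hcoeff (k l : ℕ) := Complex.conj_eq_iff_re.1
    (conj_integral_mul_fourierMode hper heven (k - l))
  have hexpand (x : ℝ) : fourierMode (m + r : ℕ) x * smoothing (fun k => c k) (r + 1) f x =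
      ∑ k ∈ range (r + 1), ∑ l ∈ range (r + 1),
        ((c k * c l * (∫ t, f t * fourierMode (k - l) t ∂circleMeasure).re : ℝ) : ℂ) *
          fourierMode (m + (r - k) + l : ℕ) x := by
    rw [smoothing_eq_sum _ _ hf, mul_sum]
    refine sum_congr rfl fun k hk => ?_
    rw [mul_sum]
    refine sum_congr rfl fun l _ => ?_
    have hfreq : ((m + (r - k) + l : ℕ) : ℤ) = (m + r : ℕ) + (l - k) := by
      have := mem_range.1 hk
      omega
    rw [hfreq, fourierMode_add_left]
    push_cast
    rw [hcoeff, Complex.conj_ofReal]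
    ring
  simp only [hexpand]
  refine .sum fun k hk => .sum fun l hl => .monomial ?_ _
  rw [mem_range] at hk hl
  rw [mem_Ico]
  omega

end Smoothing

section Block

/-- The polynomial with frequencies in `[m, m + d)` obtained by smoothing the amplitude `f` with a
kernel of degree at most `(d - 1) / 2` and shifting the spectrum to the middle of the window. -/
noncomputable def block (m d : ℕ) (f : ℝ → ℝ) (x : ℝ) : ℂ :=
  fourierMode (m + (d - 1) / 2 : ℕ) x *
    smoothing (fun k => parabolicCoeff ((d - 1) / 2 + 1) (k + 1)) ((d - 1) / 2 + 1) f x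

variable {m d : ℕ} {f : ℝ → ℝ} {L : ℝ}

lemma sum_norm_parabolicCoeff_sq (r : ℕ) :
    ∑ k ∈ range (r + 1), ‖(parabolicCoeff (r + 1) (k + 1) : ℂ)‖ ^ 2 = 1 := by
  simpa using sum_parabolicCoeff_sq (Nat.le_add_left 1 r)

lemma integral_sq_chordDist_mul_norm_parabolic_le (r : ℕ) (x : ℝ) :
    ∫ t, (chordDist t x *
      ‖trigPoly (fun k => parabolicCoeff (r + 1) (k + 1)) (r + 1) (t - x)‖) ^ 2 ∂circleMeasure ≤
        10 / (r + 2 : ℝ) ^ 2 := by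
  have hincr := sum_parabolicCoeff_increment_sq_le (Nat.le_add_left 1 r)
  rw [integral_sq_chordDist_mul_norm_trigPoly (c := fun k => parabolicCoeff (r + 1) k)
    (by simp [parabolicCoeff_zero]) (by simp [parabolicCoeff_succ_self])]
  simp only [← Complex.ofReal_sub, Complex.norm_real, Real.norm_eq_abs, sq_abs]
  refine hincr.trans_eq ?_
  push_cast
  ring

lemma isTrigPolyOn_block (hd : 1 ≤ d) (hf : Continuous f)
    (hper : Function.Periodic f (2 * Real.pi)) (heven : Function.Even f) :
    IsTrigPolyOn m d (block m d f) :=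
  isTrigPolyOn_fourierMode_mul_smoothing (by omega) hf hper heven

lemma norm_block (hf0 : ∀ t, 0 ≤ f t) (x : ℝ) : ‖block m d f x‖ =
    smoothing (fun k => parabolicCoeff ((d - 1) / 2 + 1) (k + 1)) ((d - 1) / 2 + 1) f x := by
  rw [block, norm_mul, norm_fourierMode, one_mul, Complex.norm_real, Real.norm_eq_abs,
    abs_of_nonneg (smoothing_nonneg hf0 x)]

lemma norm_block_le_one (hf : Continuous f) (hf0 : ∀ t, 0 ≤ f t) (hf1 : ∀ t, f t ≤ 1) (x : ℝ) :
    ‖block m d f x‖ ≤ 1 := by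
  rw [norm_block hf0]
  exact smoothing_le_one (sum_norm_parabolicCoeff_sq _) hf hf1 x

lemma integral_norm_block (hf : Continuous f) (hf0 : ∀ t, 0 ≤ f t) :
    ∫ x, ‖block m d f x‖ ∂circleMeasure = ∫ t, f t ∂circleMeasure := by
  simp only [norm_block hf0]
  exact integral_smoothing (sum_norm_parabolicCoeff_sq _) hf

lemma chordLipschitz_block (hd : 1 ≤ d) (hf : Continuous f) (hf0 : ∀ t, 0 ≤ f t)
    (hf1 : ∀ t, f t ≤ 1) : ChordLipschitz (2 * (m + d)) (block m d f) := by
  have hmass := sum_norm_parabolicCoeff_sq ((d - 1) / 2)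
  have hsmooth := chordLipschitz_smoothing hmass hf fun t => abs_le.2 ⟨by linarith [hf0 t], hf1 t⟩
  have hdegree : m + (d - 1) / 2 + 2 * ((d - 1) / 2 + 1) ≤ 2 * (m + d) := by omega
  refine ((chordLipschitz_fourierMode (m + (d - 1) / 2)).mul_of_norm_le_one
    (L := 2 * ((d - 1) / 2 + 1 : ℕ)) (fun x y => ?_) (fun x => (norm_fourierMode _ x).le)
    fun x => ?_).mono (by exact_mod_cast hdegree)
  · rw [← Complex.ofReal_sub, Complex.norm_real]
    exact hsmooth x y
  · rw [Complex.norm_real, Real.norm_eq_abs, abs_of_nonneg (smoothing_nonneg hf0 x)]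
    exact smoothing_le_one hmass hf hf1 x

lemma norm_block_le_add (hd : 1 ≤ d) (hf : ChordLipschitz L f) (hL : 0 ≤ L) (hf0 : ∀ t, 0 ≤ f t)
    (x : ℝ) : ‖block m d f x‖ ≤ f x + 7 * L / d := by
  set r := (d - 1) / 2
  have hd0 : (0 : ℝ) < d := by exact_mod_cast hd
  have hr : (d : ℝ) ≤ 2 * (r + 2) - 2 := by
    have hr' : d + 2 ≤ 2 * (r + 2) := by omega
    have : (d + 2 : ℝ) ≤ 2 * (r + 2) := by exact_mod_cast hr'
    linarith
  have hθ : 10 / (r + 2 : ℝ) ^ 2 ≤ (7 / d) ^ 2 := by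
    rw [div_pow, div_le_div_iff₀ (by positivity) (pow_pos hd0 2)]
    nlinarith
  rw [norm_block hf0]
  refine (smoothing_le_add (θ := 7 / d) (sum_norm_parabolicCoeff_sq _) hf hL (by positivity)
    ((integral_sq_chordDist_mul_norm_parabolic_le r x).trans hθ)).trans_eq ?_
  ring

end Block

section Cutoff

/-- An amplitude in `[0, 1]` that vanishes where `‖T‖ ≥ A`. -/
noncomputable def cutoff (A : ℝ) (T : ℝ → ℂ) (x : ℝ) : ℝ := max 0 (1 - ‖T x‖ / A)

variable {A L : ℝ} {T : ℝ → ℂ}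

lemma cutoff_nonneg (A : ℝ) (T : ℝ → ℂ) (x : ℝ) : 0 ≤ cutoff A T x := le_max_left _ _

lemma cutoff_le_one (hA : 0 ≤ A) (T : ℝ → ℂ) (x : ℝ) : cutoff A T x ≤ 1 :=
  max_le zero_le_one (sub_le_self _ (by positivity))

lemma cutoff_eq_zero (hA : 0 < A) {x : ℝ} (hx : A ≤ ‖T x‖) : cutoff A T x = 0 :=
  max_eq_left (sub_nonpos.2 ((one_le_div hA).2 hx))

@[fun_prop]
lemma continuous_cutoff (hT : Continuous T) : Continuous (cutoff A T) := by
  unfold cutoff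
  fun_prop

lemma isTrigPolyOn_block_cutoff {m d m' d' : ℕ} (hd : 1 ≤ d) (hT : IsTrigPolyOn m' d' T) :
    IsTrigPolyOn m d (block m d (cutoff A T)) :=
  isTrigPolyOn_block hd (continuous_cutoff hT.continuous)
    (fun x => by rw [cutoff, hT.periodic, cutoff])
    fun x => by rw [cutoff, hT.apply_neg, RCLike.norm_conj, cutoff]

lemma chordLipschitz_cutoff (hA : 0 < A) (hT : ChordLipschitz L T) :
    ChordLipschitz (L / A) (cutoff A T) := fun x y =>
  calc ‖cutoff A T x - cutoff A T y‖ ≤ |(1 - ‖T x‖ / A) - (1 - ‖T y‖ / A)| := by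
        simpa [cutoff] using abs_max_sub_max_le_max 0 (1 - ‖T x‖ / A) 0 (1 - ‖T y‖ / A)
    _ = |‖T x‖ - ‖T y‖| / A := by
        rw [sub_sub_sub_cancel_left, ← sub_div, abs_div, abs_sub_comm, abs_of_pos hA]
    _ ≤ L * chordDist x y / A := by
        gcongr
        exact (abs_norm_sub_norm_le _ _).trans (hT x y)
    _ = L / A * chordDist x y := by ring

lemma three_quarters_sub_le_integral_cutoff (hT : Continuous T) :
    3 / 4 - (∫ x, ‖T x‖ ^ 2 ∂circleMeasure) / A ^ 2 ≤ ∫ x, cutoff A T x ∂circleMeasure := by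
  have hpointwise (x : ℝ) : 3 / 4 - ‖T x‖ ^ 2 / A ^ 2 ≤ cutoff A T x := by
    refine le_trans ?_ (le_max_right _ _)
    rw [← div_pow]
    nlinarith [sq_nonneg (‖T x‖ / A - 1 / 2)]
  have hmono := integral_mono (integrable_circleMeasure (by fun_prop))
    (integrable_circleMeasure (by fun_prop)) hpointwise
  rwa [integral_sub (integrable_circleMeasure (by fun_prop))
    (integrable_circleMeasure (by fun_prop)), integral_const, probReal_univ, one_smul,
    integral_div] at hmono

end Cutoff

lemma norm_sum_Icc_le_of_delayed {E : Type*} [SeminormedAddCommGroup E] {v : ℕ → E}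
    {A ε : ℕ → ℝ} {κ : ℕ → ℕ} {R : ℝ} {N : ℕ} (hA : Monotone A) (hA0 : 0 ≤ A 0) (hR0 : 0 ≤ R)
    (hε : ∀ j, 0 ≤ ε j) (hκ : ∀ j, κ j ≤ j) (hR : ∀ j, 1 ≤ j → j ≤ N → (j : ℝ) ≤ κ j + R)
    (hv1 : ∀ j, 1 ≤ j → ‖v j‖ ≤ 1)
    (hv : ∀ j, 1 ≤ j → A j ≤ ‖∑ i ∈ Icc 1 (κ j), v i‖ → ‖v j‖ ≤ ε j) :
    ‖∑ i ∈ Icc 1 N, v i‖ ≤ A N + R + ∑ i ∈ Icc 1 N, ε i := by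
  induction N with
  | zero => simpa using add_nonneg hA0 hR0
  | succ N ih =>
    obtain hlarge | hsmall := le_or_gt (A (N + 1)) ‖∑ i ∈ Icc 1 (κ (N + 1)), v i‖
    · rw [sum_Icc_succ_top (by omega), sum_Icc_succ_top (by omega)]
      have hprev := ih fun j hj hjN => hR j hj (by omega)
      have hnew := hv (N + 1) (by omega) hlarge
      linarith [norm_add_le (∑ i ∈ Icc 1 N, v i) (v (N + 1)), hA N.le_succ]
    · have hκN := hκ (N + 1)
      have hsplit : ∑ i ∈ Icc 1 (N + 1), v i =
          ∑ i ∈ Icc 1 (κ (N + 1)), v i + ∑ i ∈ Ioc (κ (N + 1)) (N + 1), v i :=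
        (sum_Ioc_consecutive v (Nat.zero_le _) hκN).symm
      have htail : ‖∑ i ∈ Ioc (κ (N + 1)) (N + 1), v i‖ ≤ R := by
        refine (norm_sum_le_of_le _ fun i hi => hv1 i (by have := mem_Ioc.1 hi; omega)).trans ?_
        rw [sum_const, Nat.card_Ioc, nsmul_eq_mul, mul_one, Nat.cast_sub hκN]
        linarith [hR (N + 1) (by omega) le_rfl]
      rw [hsplit]
      linarith [norm_add_le (∑ i ∈ Icc 1 (κ (N + 1)), v i) (∑ i ∈ Ioc (κ (N + 1)) (N + 1), v i),
        sum_nonneg fun i (_ : i ∈ Icc 1 (N + 1)) => hε i]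

section BlockScale

/-- The quantity `max (m / d, 1 / ln q, 1)` of the theorem, whose logarithm to base `q` measures
how many earlier blocks the window `[m, m + d)` cannot take into account. -/
noncomputable def blockScale (q : ℝ) (m d : ℕ) : ℝ :=
  max (max ((m : ℝ) / d) (1 / Real.log q)) 1

variable {q : ℝ} (m d : ℕ)

lemma one_le_blockScale (q : ℝ) : 1 ≤ blockScale q m d := le_max_right _ _

lemma div_le_blockScale (q : ℝ) : (m : ℝ) / d ≤ blockScale q m d :=
  (le_max_left _ _).trans (le_max_left _ _)

lemma inv_log_le_blockScale (q : ℝ) : 1 / Real.log q ≤ blockScale q m d :=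
  (le_max_right _ _).trans (le_max_left _ _)

lemma div_sub_one_le_two_mul_blockScale (hq : 1 < q) : q / (q - 1) ≤ 2 * blockScale q m d := by
  have hq' : 0 < q - 1 := sub_pos.2 hq
  have hlog : 1 / (q - 1) ≤ 1 / Real.log q :=
    one_div_le_one_div_of_le (Real.log_pos hq) (Real.log_le_sub_one_of_pos (by linarith))
  have hsplit : q / (q - 1) = 1 + 1 / (q - 1) := by
    field_simp
    ring
  linarith [one_le_blockScale m d q, inv_log_le_blockScale m d q]

lemma sq_le_pow_ceil_two_mul_logb {y : ℝ} (hq : 1 < q) (hy : 0 < y) :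
    y ^ 2 ≤ q ^ ⌈2 * Real.logb q y⌉₊ :=
  calc y ^ 2 = q ^ (2 * Real.logb q y) := by
        rw [mul_comm, Real.rpow_mul (by linarith), Real.rpow_logb (by linarith) hq.ne' hy,
          Real.rpow_two]
    _ ≤ q ^ (⌈2 * Real.logb q y⌉₊ : ℝ) := Real.rpow_le_rpow_of_exponent_le hq.le (Nat.le_ceil _)
    _ = q ^ ⌈2 * Real.logb q y⌉₊ := Real.rpow_natCast _ _

lemma logb_natCast_le (hq : 1 < q) {N : ℕ} (hN : 1 ≤ N) :
    Real.logb q N ≤ 2 * Real.sqrt N + 2 * Real.logb q (blockScale q m d) := by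
  have hlogq := Real.log_pos hq
  have hsqrt : 0 < Real.sqrt N := Real.sqrt_pos.2 (by exact_mod_cast hN)
  have hX : 0 < blockScale q m d := one_pos.trans_le (one_le_blockScale m d q)
  have hlogX : 1 ≤ blockScale q m d * Real.log q :=
    (div_le_iff₀ hlogq).1 (inv_log_le_blockScale m d q)
  have hratio : Real.sqrt N / blockScale q m d ≤ Real.sqrt N * Real.log q := by
    rw [div_le_iff₀ hX, mul_assoc, mul_comm (Real.log q)]
    exact le_mul_of_one_le_right hsqrt.le hlogX
  have hlogratio : Real.log (Real.sqrt N) - Real.log (blockScale q m d) ≤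
      Real.sqrt N / blockScale q m d := by
    rw [← Real.log_div hsqrt.ne' hX.ne']
    exact (Real.log_le_sub_one_of_pos (by positivity)).trans (sub_le_self _ zero_le_one)
  have hlogN : Real.log N = 2 * Real.log (Real.sqrt N) := by
    rw [Real.log_sqrt N.cast_nonneg]
    ring
  rw [Real.logb, Real.logb, hlogN, div_le_iff₀ hlogq, add_mul, mul_assoc 2 (_ / _),
    div_mul_cancel₀ _ hlogq.ne']
  linarith

end BlockScale

/-- The hypotheses of the theorem: the frequencies `m j`, `j ≥ 1`, grow at least geometrically with
ratio `q`, and the windows `[m j, m j + d j)` are nonempty and pairwise disjoint. -/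
structure LacunaryWindows (q : ℝ) (m d : ℕ → ℕ) : Prop where
  one_lt : 1 < q
  pos : ∀ j, 1 ≤ j → 0 < m j
  le_ratio : ∀ j, 1 ≤ j → q ≤ (m (j + 1) : ℝ) / (m j : ℝ)
  window : ∀ j, 1 ≤ j → 1 ≤ d j ∧ m j + d j ≤ m (j + 1)

/-- The length of the partial sum that the `j`-th block takes into account. The delay
`2 log_q (j * blockScale)` is what makes the smoothing error of that block at most `14 / j²`. -/
noncomputable def inspectedIndex (q : ℝ) (m d : ℕ → ℕ) (j : ℕ) : ℕ :=
  j - 1 - ⌈2 * Real.logb q (blockScale q (m j) (d j) * j)⌉₊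

/-- The polynomials `δ_j` of the theorem: the amplitude of `δ_j` is cut off where the inspected
partial sum has modulus at least `2 √j`. -/
noncomputable def delayedBlock (q : ℝ) (m d : ℕ → ℕ) (j : ℕ) : ℝ → ℂ :=
  block (m j) (d j) (cutoff (2 * Real.sqrt j) fun x =>
    ∑ i ∈ (Icc 1 (inspectedIndex q m d j)).attach, delayedBlock q m d i x)
termination_by j
decreasing_by
  have hi := i.2
  simp only [inspectedIndex, mem_Icc] at hi
  omega

/-- The partial sums `∑_{1 ≤ j ≤ k} δ_j`. -/
noncomputable def partialSum (q : ℝ) (m d : ℕ → ℕ) (k : ℕ) (x : ℝ) : ℂ :=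
  ∑ i ∈ Icc 1 k, delayedBlock q m d i x

section Recursion

variable (q : ℝ) (m d : ℕ → ℕ)

lemma inspectedIndex_le (j : ℕ) : inspectedIndex q m d j ≤ j :=
  (Nat.sub_le _ _).trans (Nat.sub_le _ _)

lemma delayedBlock_eq (j : ℕ) : delayedBlock q m d j = block (m j) (d j)
    (cutoff (2 * Real.sqrt j) (partialSum q m d (inspectedIndex q m d j))) := by
  rw [delayedBlock]
  congr 2
  funext x
  exact sum_attach _ fun i => delayedBlock q m d i x

lemma partialSum_zero (x : ℝ) : partialSum q m d 0 x = 0 := by simp [partialSum]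

lemma partialSum_succ (k : ℕ) (x : ℝ) :
    partialSum q m d (k + 1) x = partialSum q m d k x + delayedBlock q m d (k + 1) x :=
  sum_Icc_succ_top (by omega) _

end Recursion

namespace LacunaryWindows

variable {q : ℝ} {m d : ℕ → ℕ} (h : LacunaryWindows q m d)

include h

lemma mul_le_succ {j : ℕ} (hj : 1 ≤ j) : q * m j ≤ m (j + 1) :=
  (le_div_iff₀ (by exact_mod_cast h.pos j hj)).1 (h.le_ratio j hj)

lemma mono {i j : ℕ} (hi : 1 ≤ i) (hij : i ≤ j) : m i ≤ m j := by
  induction j, hij using Nat.le_induction with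
  | base => rfl
  | succ j hij ih => exact ih.trans (Nat.le_of_add_right_le (h.window j (hi.trans hij)).2)

lemma mul_pow_le {k : ℕ} (hk : 1 ≤ k) (i : ℕ) : (m k : ℝ) * q ^ i ≤ m (k + i) := by
  induction i with
  | zero => simp
  | succ i ih =>
    have hq : 0 ≤ q := zero_le_one.trans h.one_lt.le
    calc (m k : ℝ) * q ^ (i + 1) = q * (m k * q ^ i) := by ring
      _ ≤ q * m (k + i) := by gcongr
      _ ≤ m (k + (i + 1)) := h.mul_le_succ (by omega)

lemma sum_succ_le (k : ℕ) :
    ∑ i ∈ Icc 1 k, (m (i + 1) : ℝ) ≤ q / (q - 1) * m (k + 1) := by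
  have hq : 0 < q - 1 := sub_pos.2 h.one_lt
  induction k with
  | zero =>
    have hq0 : 0 < q := one_pos.trans h.one_lt
    rw [Icc_eq_empty (by norm_num), sum_empty]
    positivity
  | succ k ih =>
    rw [sum_Icc_succ_top (by omega)]
    calc ∑ i ∈ Icc 1 k, (m (i + 1) : ℝ) + m (k + 1 + 1)
        ≤ q / (q - 1) * m (k + 1) + m (k + 1 + 1) := by gcongr
      _ = 1 / (q - 1) * (q * m (k + 1)) + m (k + 1 + 1) := by ring
      _ ≤ 1 / (q - 1) * m (k + 1 + 1) + m (k + 1 + 1) := by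
          gcongr
          exact h.mul_le_succ (by omega)
      _ = q / (q - 1) * m (k + 1 + 1) := by
          field_simp
          ring

lemma isTrigPolyOn_delayedBlock_and_partialSum (n : ℕ) :
    (1 ≤ n → IsTrigPolyOn (m n) (d n) (delayedBlock q m d n)) ∧
      IsTrigPolyOn 0 (m (n + 1)) (partialSum q m d n) := by
  induction n using Nat.strong_induction_on with
  | _ n ih =>
    have hblock (hn : 1 ≤ n) : IsTrigPolyOn (m n) (d n) (delayedBlock q m d n) := by
      rw [delayedBlock_eq]
      refine isTrigPolyOn_block_cutoff (h.window n hn).1 (ih _ ?_).2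
      rw [inspectedIndex]
      omega
    refine ⟨hblock, .sum fun i hi => ?_⟩
    obtain ⟨hi1, hin⟩ := mem_Icc.1 hi
    have hi_block : IsTrigPolyOn (m i) (d i) (delayedBlock q m d i) := by
      obtain rfl | hlt := hin.eq_or_lt
      exacts [hblock hi1, (ih i hlt).1 hi1]
    have hwindow := (h.window i hi1).2
    have hmono := h.mono (by omega : 1 ≤ i + 1) (by omega : i + 1 ≤ n + 1)
    exact hi_block.mono (Nat.zero_le _) (by omega)

lemma isTrigPolyOn_delayedBlock {j : ℕ} (hj : 1 ≤ j) :
    IsTrigPolyOn (m j) (d j) (delayedBlock q m d j) :=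
  (h.isTrigPolyOn_delayedBlock_and_partialSum j).1 hj

lemma isTrigPolyOn_partialSum (k : ℕ) : IsTrigPolyOn 0 (m (k + 1)) (partialSum q m d k) :=
  (h.isTrigPolyOn_delayedBlock_and_partialSum k).2

lemma continuous_cutoff_partialSum (A : ℝ) (k : ℕ) :
    Continuous (cutoff A (partialSum q m d k)) :=
  continuous_cutoff (h.isTrigPolyOn_partialSum k).continuous

lemma norm_delayedBlock_le_one (j : ℕ) (x : ℝ) : ‖delayedBlock q m d j x‖ ≤ 1 := by
  rw [delayedBlock_eq]
  exact norm_block_le_one (h.continuous_cutoff_partialSum _ _) (cutoff_nonneg _ _)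
    (cutoff_le_one (by positivity) _) x

lemma chordLipschitz_partialSum (k : ℕ) :
    ChordLipschitz (2 * (q / (q - 1) * m (k + 1))) (partialSum q m d k) := by
  have hblock (j : ℕ) (hj : j ∈ Icc 1 k) :
      ChordLipschitz (2 * m (j + 1)) (delayedBlock q m d j) := by
    obtain ⟨hd, hwindow⟩ := h.window j (mem_Icc.1 hj).1
    rw [delayedBlock_eq]
    refine (chordLipschitz_block hd (h.continuous_cutoff_partialSum _ _) (cutoff_nonneg _ _)
      (cutoff_le_one (by positivity) _)).mono ?_
    gcongr
    exact_mod_cast hwindow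
  refine (ChordLipschitz.sum hblock).mono ?_
  rw [← mul_sum]
  gcongr
  exact h.sum_succ_le k

lemma integral_norm_partialSum_sq_le (k : ℕ) :
    ∫ x, ‖partialSum q m d k x‖ ^ 2 ∂circleMeasure ≤ k := by
  induction k with
  | zero => simp [partialSum_zero]
  | succ k ih =>
    have hpoly := h.isTrigPolyOn_delayedBlock k.succ_pos
    have hcont := hpoly.continuous
    have hblock : ∫ x, ‖delayedBlock q m d (k + 1) x‖ ^ 2 ∂circleMeasure ≤ 1 := by
      refine (integral_mono (g := fun _ => (1 : ℝ)) (integrable_circleMeasure (by fun_prop))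
        (integrable_const _) fun x => ?_).trans_eq (by simp)
      exact pow_le_one₀ (norm_nonneg _) (h.norm_delayedBlock_le_one _ x)
    simp only [partialSum_succ]
    rw [(h.isTrigPolyOn_partialSum k).integral_norm_add_sq hpoly (zero_add _).le]
    push_cast
    gcongr

lemma half_le_integral_norm_delayedBlock {j : ℕ} (hj : 1 ≤ j) :
    1 / 2 ≤ ∫ x, ‖delayedBlock q m d j x‖ ∂circleMeasure := by
  have hj0 : (0 : ℝ) < j := by exact_mod_cast hj
  set κ := inspectedIndex q m d j
  have henergy : ∫ x, ‖partialSum q m d κ x‖ ^ 2 ∂circleMeasure ≤ j :=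
    (h.integral_norm_partialSum_sq_le κ).trans (by exact_mod_cast inspectedIndex_le q m d j)
  have hquarter : (∫ x, ‖partialSum q m d κ x‖ ^ 2 ∂circleMeasure) / (2 * Real.sqrt j) ^ 2 ≤
      1 / 4 := by
    rw [mul_pow, Real.sq_sqrt hj0.le, div_le_iff₀ (by linarith)]
    linarith
  rw [delayedBlock_eq, integral_norm_block (h.continuous_cutoff_partialSum _ _)
    (cutoff_nonneg _ _)]
  linarith [three_quarters_sub_le_integral_cutoff (A := 2 * Real.sqrt j)
    (h.isTrigPolyOn_partialSum κ).continuous]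

lemma delay_error_le {j : ℕ} (hκ : 1 ≤ inspectedIndex q m d j) :
    q / (q - 1) * m (inspectedIndex q m d j + 1) / d j ≤ 2 / (j : ℝ) ^ 2 := by
  have : 0 < q := one_pos.trans h.one_lt
  have hj : 1 ≤ j := hκ.trans (inspectedIndex_le q m d j)
  have hd : (0 : ℝ) < d j := by exact_mod_cast (h.window j hj).1
  have : (0 : ℝ) < j := by exact_mod_cast hj
  set X := blockScale q (m j) (d j) with hX
  set s := ⌈2 * Real.logb q (X * j)⌉₊ with hs
  set κ := inspectedIndex q m d j with hκ_def
  have hX0 : 0 < X := one_pos.trans_le (one_le_blockScale _ _ q)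
  have hindex : κ + 1 + s = j := by
    rw [hκ_def, inspectedIndex, ← hX, ← hs] at hκ ⊢
    omega
  have hgap : m (κ + 1) * (X * j) ^ 2 ≤ X * d j :=
    calc (m (κ + 1) : ℝ) * (X * j) ^ 2 ≤ m (κ + 1) * q ^ s := by
          gcongr
          exact sq_le_pow_ceil_two_mul_logb h.one_lt (by positivity)
      _ ≤ m (κ + 1 + s) := h.mul_pow_le (by omega) s
      _ = m j := by rw [hindex]
      _ ≤ X * d j := (div_le_iff₀ hd).1 (div_le_blockScale _ _ q)
  rw [div_le_div_iff₀ hd (by positivity)]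
  refine le_of_mul_le_mul_right ?_ hX0
  calc q / (q - 1) * m (κ + 1) * (j : ℝ) ^ 2 * X
      ≤ 2 * X * m (κ + 1) * (j : ℝ) ^ 2 * X := by
        gcongr
        exact div_sub_one_le_two_mul_blockScale _ _ h.one_lt
    _ = 2 * (m (κ + 1) * (X * j) ^ 2) := by ring
    _ ≤ 2 * (X * d j) := by gcongr
    _ = 2 * d j * X := by ring

lemma norm_delayedBlock_le_of_large {j : ℕ} (hj : 1 ≤ j) {x : ℝ}
    (hlarge : 2 * Real.sqrt j ≤ ‖partialSum q m d (inspectedIndex q m d j) x‖) :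
    ‖delayedBlock q m d j x‖ ≤ 14 * ((j : ℝ) ^ 2)⁻¹ := by
  have hq : 0 < q - 1 := sub_pos.2 h.one_lt
  have hq0 : 0 < q := one_pos.trans h.one_lt
  have hsqrt : 1 ≤ Real.sqrt j := Real.one_le_sqrt.2 (by exact_mod_cast hj)
  have hthreshold : 0 < 2 * Real.sqrt j := by positivity
  have hκ : 1 ≤ inspectedIndex q m d j := by
    by_contra! hκ0
    rw [Nat.lt_one_iff.1 hκ0, partialSum_zero, norm_zero] at hlarge
    exact hthreshold.not_ge hlarge
  set M := q / (q - 1) * m (inspectedIndex q m d j + 1)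
  have hM : 0 ≤ M := by positivity
  have hlip : ChordLipschitz M
      (cutoff (2 * Real.sqrt j) (partialSum q m d (inspectedIndex q m d j))) :=
    (chordLipschitz_cutoff hthreshold (h.chordLipschitz_partialSum _)).mono <| by
      rw [mul_div_mul_left _ _ two_ne_zero]
      exact div_le_self hM hsqrt
  have hleak := norm_block_le_add (m := m j) (h.window j hj).1 hlip hM (cutoff_nonneg _ _) x
  rw [cutoff_eq_zero hthreshold hlarge, zero_add, ← delayedBlock_eq] at hleak
  calc ‖delayedBlock q m d j x‖ ≤ 7 * M / d j := hleak
    _ = 7 * (M / d j) := mul_div_assoc _ _ _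
    _ ≤ 7 * (2 / (j : ℝ) ^ 2) := mul_le_mul_of_nonneg_left (h.delay_error_le hκ) (by norm_num)
    _ = 14 * ((j : ℝ) ^ 2)⁻¹ := by ring

lemma sub_inspectedIndex_le {B : ℝ} {N j : ℕ} (hj : 1 ≤ j) (hjN : j ≤ N)
    (hB : Real.logb q (blockScale q (m j) (d j)) ≤ B) :
    (j : ℝ) ≤ inspectedIndex q m d j + (2 + 4 * Real.sqrt N + 6 * B) := by
  set X := blockScale q (m j) (d j) with hX
  set s := ⌈2 * Real.logb q (X * j)⌉₊ with hs
  have hj1 : (1 : ℝ) ≤ j := by exact_mod_cast hj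
  have hX1 : 1 ≤ X := one_le_blockScale _ _ q
  have hindex : (j : ℝ) ≤ inspectedIndex q m d j + (1 + s) := by
    have hindexℕ : j ≤ inspectedIndex q m d j + (1 + s) := by
      rw [inspectedIndex, ← hX, ← hs]
      omega
    exact_mod_cast hindexℕ
  have hs_lt : s < 2 * Real.logb q (X * j) + 1 :=
    Nat.ceil_lt_add_one <| mul_nonneg zero_le_two <|
      Real.logb_nonneg h.one_lt (one_le_mul_of_one_le_of_one_le hX1 hj1)
  rw [Real.logb_mul (by positivity) (by positivity)] at hs_lt
  have hsqrt : Real.sqrt j ≤ Real.sqrt N := Real.sqrt_le_sqrt (by exact_mod_cast hjN)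
  linarith [logb_natCast_le (m j) (d j) h.one_lt hj]

lemma norm_partialSum_le {B : ℝ} {N : ℕ} (hN : 1 ≤ N)
    (hB : ∀ j ∈ Icc 1 N, Real.logb q (blockScale q (m j) (d j)) ≤ B) (x : ℝ) :
    ‖partialSum q m d N x‖ ≤ 30 + 6 * Real.sqrt N + 6 * B := by
  have hB0 : 0 ≤ B := (Real.logb_nonneg h.one_lt (one_le_blockScale (m 1) (d 1) q)).trans
    (hB 1 (left_mem_Icc.2 hN))
  have hsum : ∑ j ∈ Icc 1 N, 14 * ((j : ℝ) ^ 2)⁻¹ ≤ 28 := by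
    rw [← mul_sum]
    have hzeta := sum_Ioo_inv_sq_le (α := ℝ) 0 (N + 1)
    have hIcc : Icc 1 N = Ioo 0 (N + 1) := by
      ext
      simp only [mem_Icc, mem_Ioo]
      omega
    rw [hIcc]
    norm_num at hzeta ⊢
    linarith
  have hmono : Monotone fun j : ℕ => 2 * Real.sqrt j := fun i j hij => by
    dsimp only
    gcongr
  have hdelay := norm_sum_Icc_le_of_delayed (v := fun j => delayedBlock q m d j x)
    (ε := fun j => 14 * ((j : ℝ) ^ 2)⁻¹) (R := 2 + 4 * Real.sqrt N + 6 * B) hmono (by simp)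
    (by positivity) (fun j => by positivity) (inspectedIndex_le q m d)
    (fun j hj hjN => h.sub_inspectedIndex_le hj hjN (hB j (mem_Icc.2 ⟨hj, hjN⟩)))
    (fun j _ => h.norm_delayedBlock_le_one j x) (fun j hj => h.norm_delayedBlock_le_of_large hj)
  rw [partialSum]
  linarith

end LacunaryWindows

theorem theorem1 :
    ∃ α β γ : ℝ, 0 < α ∧ 0 < β ∧ 0 < γ ∧
      ∀ (q : ℝ) (m d : ℕ → ℕ), 1 < q →
        (∀ j : ℕ, 1 ≤ j → 0 < m j) →
        (∀ j : ℕ, 1 ≤ j → q ≤ (m (j + 1) : ℝ) / (m j : ℝ)) →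
        (∀ j : ℕ, 1 ≤ j → 1 ≤ d j ∧ m j + d j ≤ m (j + 1)) →
        ∃ δ : ℕ → ℝ → ℂ,
          (∀ j : ℕ, 1 ≤ j → IsTrigPolyOn (m j) (d j) (δ j)) ∧
          (∀ j : ℕ, 1 ≤ j →
            1 / 8 ≤ eLpNorm (δ j) 1 circleMeasure ∧
            eLpNorm (δ j) 1 circleMeasure ≤ eLpNorm (δ j) ⊤ circleMeasure ∧
            eLpNorm (δ j) ⊤ circleMeasure ≤ 7) ∧
          (∀ (N : ℕ) (hN : 1 ≤ N),
            eLpNorm (fun x : ℝ => ∑ j ∈ Finset.Icc 1 N, δ j x) ⊤ circleMeasure ≤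
              ENNReal.ofReal (α + β * Real.sqrt (N : ℝ) +
                γ * (Finset.Icc 1 N).sup' (Finset.nonempty_Icc.mpr hN) (fun j : ℕ =>
                  Real.logb q
                    (max (max ((m j : ℝ) / (d j : ℝ)) (1 / Real.log q)) 1)))) := by
  refine ⟨30, 6, 6, by norm_num, by norm_num, by norm_num, fun q m d hq hm hratio hd => ?_⟩
  have h : LacunaryWindows q m d := ⟨hq, hm, hratio, hd⟩
  refine ⟨delayedBlock q m d, fun j hj => h.isTrigPolyOn_delayedBlock hj, fun j hj => ?_,
    fun N hN => ?_⟩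
  · have hcont := (h.isTrigPolyOn_delayedBlock hj).continuous
    refine ⟨?_, eLpNorm_le_eLpNorm_of_exponent_le le_top hcont.aestronglyMeasurable, ?_⟩
    · rw [eLpNorm_one_eq_lintegral_enorm,
        ← ofReal_integral_norm_eq_lintegral_enorm (integrable_circleMeasure hcont)]
      calc (1 / 8 : ENNReal) = ENNReal.ofReal (1 / 8) := by
            rw [ENNReal.ofReal_div_of_pos (by norm_num)]
            norm_num
        _ ≤ _ := ENNReal.ofReal_le_ofReal (by linarith [h.half_le_integral_norm_delayedBlock hj])
    · exact (eLpNorm_top_circleMeasure_le (h.norm_delayedBlock_le_one j)).trans (by norm_num)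
  · exact eLpNorm_top_circleMeasure_le <| h.norm_partialSum_le hN fun j hj =>
      le_sup' (fun j => Real.logb q (blockScale q (m j) (d j))) hj
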